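/- **Theorem 5.1.** Let $F$ be a non-archimedean local field (for example a $p$-adic field) with residue field of order $q$. Let $W_F$ be its Weil group, with inertia subgroup $I=I_F$ (open in $W_F$, with its profinite topology) and wild inertia subgroup $P_F$, and let $\mathrm{Fr}\in W_F$ be a geometric Frobenius element. Let $\kappa$ be a field of characteristic zero, and let $\rho$ be a finite-dimensional semisimple representation of $W_F$ over $\kappa$ that is smooth (continuous for the discrete topology on $\kappa$) and tamely ramified (trivial on $P_F$). Let $\sigma=\rho(s)$, where $s\in I_F$ maps to a topological generator of the tame inertia group $I_F/P_F$, and write $\mathrm{Fr}$ also for $\rho(\mathrm{Fr})$. For an endomorphism $A$ of a finite-dimensional $\kappa$-vector space put $\mathrm{Char}(A)(X)=\det(1-XA)\in\kappa[X]$, and let $$L(\rho,X)=\det\left(1-X\,\mathrm{Fr}\mid\rho^{I}\right)^{-1}\in\kappa(X),$$ where $\rho^I$ is the subspace of $I$-invariants. Then $$\det(1+\sigma+\dots+\sigma^{q-1})=q^{\dim_\kappa\rho^{I}},$$ and, in $\kappa(X)$, $$\frac{\mathrm{Char}(\mathrm{Fr})(X)}{\mathrm{Char}\big((1+\sigma+\dots+\sigma^{q-1})\,\mathrm{Fr}\big)(X)}=\frac{L(\rho,qX)}{L(\rho,X)}.$$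 -/

import Mathlib

/-!
Throughout, a non-archimedean local field is a field `F` with a nontrivial ultrametric absolute
value for which it is locally compact.  `AlgebraicClosure F` carries the unique extension of that
absolute value, which is the spectral norm.
-/

namespace LocalWeil

open Polynomial

section Galois

variable (F : Type*) [NontriviallyNormedField F] [IsUltrametricDist F]

/-- The order `q` of the residue field of the valuation ring `{x : ‖x‖ ≤ 1}` of `F`. -/
noncomputable def residueCard : ℕ :=
  Nat.card (IsLocalRing.ResidueField (NormedField.valuation (K := F)).valuationSubring)

/-- The unique extension to the algebraic closure of the absolute value of `F`. -/
noncomputable def absVal (x : AlgebraicClosure F) : ℝ :=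
  spectralNorm F (AlgebraicClosure F) x

variable {F}

theorem absVal_sub_lt {x y z : AlgebraicClosure F} {r : ℝ}
    (h₁ : absVal F (x - y) < r) (h₂ : absVal F (y - z) < r) : absVal F (x - z) < r := by
  have h := isNonarchimedean_spectralNorm (K := F) (L := AlgebraicClosure F) (x - y) (y - z)
  rw [sub_add_sub_cancel] at h
  exact lt_of_le_of_lt h (max_lt h₁ h₂)

theorem absVal_sub_comm (x y : AlgebraicClosure F) : absVal F (x - y) = absVal F (y - x) := by
  rw [← neg_sub]
  exact spectralNorm_neg (Algebra.IsAlgebraic.isAlgebraic _)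

theorem absVal_equiv (g : AlgebraicClosure F ≃ₐ[F] AlgebraicClosure F) (x : AlgebraicClosure F) :
    absVal F (g x) = absVal F x :=
  (spectralNorm_eq_of_equiv g x).symm

theorem absVal_mul_le (x y : AlgebraicClosure F) : absVal F (x * y) ≤ absVal F x * absVal F y :=
  spectralNorm_mul (Algebra.IsAlgebraic.isAlgebraic _) (Algebra.IsAlgebraic.isAlgebraic _)

theorem absVal_nonneg (x : AlgebraicClosure F) : 0 ≤ absVal F x := spectralNorm_nonneg x

theorem absVal_pow_le_one {x : AlgebraicClosure F} (hx : absVal F x ≤ 1) (k : ℕ) :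
    absVal F (x ^ k) ≤ 1 := by
  induction k with
  | zero => rw [pow_zero]; exact le_of_eq spectralNorm_one
  | succ k ih =>
    rw [pow_succ]
    exact (absVal_mul_le _ _).trans (mul_le_one₀ ih (absVal_nonneg _) hx)

theorem absVal_pow_sub_pow_lt {x y : AlgebraicClosure F} (hx : absVal F x ≤ 1)
    (hy : absVal F y ≤ 1) (h : absVal F (x - y) < 1) (k : ℕ) :
    absVal F (x ^ k - y ^ k) < 1 := by
  induction k with
  | zero =>
    rw [pow_zero, pow_zero, sub_self]
    exact lt_of_eq_of_lt spectralNorm_zero one_pos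
  | succ k ih =>
    refine absVal_sub_lt (y := x ^ k * y) ?_ ?_
    · rw [pow_succ, ← mul_sub]
      exact lt_of_le_of_lt (absVal_mul_le _ _)
        (lt_of_le_of_lt (mul_le_of_le_one_left (absVal_nonneg _) (absVal_pow_le_one hx k)) h)
    · rw [pow_succ, ← sub_mul]
      exact lt_of_le_of_lt (absVal_mul_le _ _)
        (lt_of_le_of_lt (mul_le_of_le_one_right (absVal_nonneg _) hy) ih)

/-- `g` acts on the residue field of the algebraic closure as the `(m - n)`-th power of the
arithmetic Frobenius `x ↦ x ^ q`. -/
def ActsAsFrobPow (g : AlgebraicClosure F ≃ₐ[F] AlgebraicClosure F) (m n : ℕ) : Prop :=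
  ∀ x : AlgebraicClosure F, absVal F x ≤ 1 →
    absVal F ((g x) ^ residueCard F ^ n - x ^ residueCard F ^ m) < 1

variable (F)

/-- The Weil group as an abstract subgroup of the Galois group: the elements that act on the residue
field of the algebraic closure as an integral power of the Frobenius. -/
def weilSubgroup : Subgroup (AlgebraicClosure F ≃ₐ[F] AlgebraicClosure F) where
  carrier := {g | ∃ m n : ℕ, ActsAsFrobPow g m n}
  one_mem' := ⟨0, 0, fun x _ => by
    simp [absVal, spectralNorm_zero]⟩
  mul_mem' := by
    rintro g h ⟨m, n, hg⟩ ⟨m', n', hh⟩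
    refine ⟨m + m', n + n', fun x hx => ?_⟩
    have hx' : absVal F (h x) ≤ 1 := by rw [absVal_equiv]; exact hx
    have hx'' : absVal F (g (h x)) ≤ 1 := by rw [absVal_equiv]; exact hx'
    have e₁ := absVal_pow_sub_pow_lt (absVal_pow_le_one hx'' _) (absVal_pow_le_one hx' _)
      (hg (h x) hx') (residueCard F ^ n')
    have e₂ := absVal_pow_sub_pow_lt (absVal_pow_le_one hx' _) (absVal_pow_le_one hx _)
      (hh x hx) (residueCard F ^ m)
    rw [AlgEquiv.mul_apply, pow_add, pow_add, pow_mul, mul_comm (residueCard F ^ m), pow_mul]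
    refine absVal_sub_lt e₁ ?_
    rw [← pow_mul, mul_comm, pow_mul]
    exact e₂
  inv_mem' := by
    rintro g ⟨m, n, hg⟩
    refine ⟨n, m, fun x hx => ?_⟩
    have h := hg (g⁻¹ x) (by rw [absVal_equiv]; exact hx)
    rw [show g (g⁻¹ x) = x from g.apply_symm_apply x] at h
    rw [absVal_sub_comm]
    exact h

/-- The inertia group: the automorphisms acting trivially on the residue field of the
algebraic closure. -/
def inertiaGal : Subgroup (AlgebraicClosure F ≃ₐ[F] AlgebraicClosure F) where
  carrier := {g | ∀ x, absVal F x ≤ 1 → absVal F (g x - x) < 1}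
  one_mem' := fun x _ => by
    simp [absVal, spectralNorm_zero]
  mul_mem' := fun {g h} hg hh x hx =>
    absVal_sub_lt (hg (h x) (by rw [absVal_equiv]; exact hx)) (hh x hx)
  inv_mem' := fun {g} hg x hx => by
    have h := hg (g⁻¹ x) (by rw [absVal_equiv]; exact hx)
    rw [show g (g⁻¹ x) = x from g.apply_symm_apply x, absVal_sub_comm] at h
    exact h

/-- The wild inertia group: the automorphisms `g` with `g x / x ≡ 1` modulo the maximal ideal
for all `x ≠ 0`.  It is the inverse limit of the first ramification groups `G₁` of the finite
Galois subextensions. -/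
def wildInertiaGal : Subgroup (AlgebraicClosure F ≃ₐ[F] AlgebraicClosure F) where
  carrier := {g | ∀ x, x ≠ 0 → absVal F (g x - x) < absVal F x}
  one_mem' := fun x hx => by
    simpa [absVal, spectralNorm_zero] using
      spectralNorm_zero_lt hx (Algebra.IsAlgebraic.isAlgebraic (R := F) x)
  mul_mem' := fun {g h} hg hh x hx => by
    have h₁ := hg (h x) ((map_ne_zero h).2 hx)
    rw [absVal_equiv h] at h₁
    exact absVal_sub_lt h₁ (hh x hx)
  inv_mem' := fun {g} hg x hx => by
    have h := hg (g⁻¹ x) ((map_ne_zero (g⁻¹)).2 hx)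
    rw [show g (g⁻¹ x) = x from g.apply_symm_apply x, absVal_sub_comm, absVal_equiv (g⁻¹)] at h
    exact h

/-- The Weil group `W_F`, as a type of its own because its topology is not the subspace topology
of the Galois group. -/
def WeilGroup : Type _ := weilSubgroup F

noncomputable instance : Group (WeilGroup F) := inferInstanceAs (Group (weilSubgroup F))

/-- The inclusion of the Weil group in the absolute Galois group. -/
noncomputable def WeilGroup.toGal : WeilGroup F →* (AlgebraicClosure F ≃ₐ[F] AlgebraicClosure F) :=
  (weilSubgroup F).subtype

/-- The inertia group `I_F` as a subgroup of `W_F` (it is contained in it). -/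
noncomputable def inertia : Subgroup (WeilGroup F) := (inertiaGal F).comap (WeilGroup.toGal F)

/-- The wild inertia group `P_F` as a subgroup of `W_F`. -/
noncomputable def wildInertia : Subgroup (WeilGroup F) := (wildInertiaGal F).comap (WeilGroup.toGal F)

theorem inertiaGal_le_weilSubgroup : inertiaGal F ≤ weilSubgroup F :=
  fun g hg => ⟨0, 0, fun x hx => by simpa using hg x hx⟩

theorem wildInertiaGal_le_inertiaGal : wildInertiaGal F ≤ inertiaGal F := fun g hg x hx => by
  by_cases h : x = 0
  · subst h
    simp [absVal, spectralNorm_zero]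
  · exact lt_of_lt_of_le (hg x h) hx

instance : (inertiaGal F).Normal where
  conj_mem := fun g hg h x hx => by
    have h₁ := hg (h⁻¹ x) (by rw [absVal_equiv]; exact hx)
    rw [← absVal_equiv h, map_sub, show h (h⁻¹ x) = x from h.apply_symm_apply x] at h₁
    exact h₁

instance : (wildInertiaGal F).Normal where
  conj_mem := fun g hg h x hx => by
    have h₁ := hg (h⁻¹ x) ((map_ne_zero (h⁻¹)).2 hx)
    rw [← absVal_equiv h, map_sub, show h (h⁻¹ x) = x from h.apply_symm_apply x,
      absVal_equiv (h⁻¹)] at h₁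
    exact h₁

instance : (inertia F).Normal := inferInstanceAs ((inertiaGal F).comap (WeilGroup.toGal F)).Normal

instance : (wildInertia F).Normal :=
  inferInstanceAs ((wildInertiaGal F).comap (WeilGroup.toGal F)).Normal

/-- The topology of the Weil group: the coarsest one for which the inclusion into the Galois group
(with the Krull topology) and the map to the discrete coset space `W_F / I_F` are continuous.
Thus `I_F` is open and carries its profinite topology. -/
noncomputable instance : TopologicalSpace (WeilGroup F) :=
  TopologicalSpace.induced (WeilGroup.toGal F) inferInstance ⊓
    TopologicalSpace.induced (QuotientGroup.mk : WeilGroup F → WeilGroup F ⧸ inertia F) ⊥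

variable {F}

/-- A geometric Frobenius element: it acts on the residue field of the algebraic closure as the
inverse of `x ↦ x ^ q`. -/
def IsGeometricFrobenius (φ : WeilGroup F) : Prop :=
  ActsAsFrobPow (WeilGroup.toGal F φ) 0 1

/-- `s ∈ I_F` maps to a topological generator of the tame inertia group `I_F / P_F`. -/
def IsTameGenerator (s : inertia F) : Prop :=
  Dense (Subgroup.zpowers
    (QuotientGroup.mk s : inertia F ⧸ (wildInertia F).subgroupOf (inertia F)) :
      Set (inertia F ⧸ (wildInertia F).subgroupOf (inertia F)))

end Galois

section Representations

variable {κ V : Type*} [Field κ] [AddCommGroup V] [Module κ V] [FiniteDimensional κ V]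

/-- The characteristic polynomial in the normalization `det (1 - X A)`. -/
noncomputable def charRev (A : Module.End κ V) : κ[X] :=
  (LinearMap.toMatrix (Module.finBasis κ V) (Module.finBasis κ V) A).charpolyRev

/-- `det (1 - X A)` does not depend on the basis. -/
theorem charRev_eq_reverse (A : Module.End κ V) : charRev A = A.charpoly.reverse := by
  rw [charRev, ← Matrix.reverse_charpoly, LinearMap.charpoly_toMatrix]

variable {F : Type*} [NontriviallyNormedField F] [IsUltrametricDist F]

/-- A finite-dimensional representation is smooth if it is continuous for the discrete topology
on its target. -/
def IsSmooth (ρ : Representation κ (WeilGroup F) V) : Prop :=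
  IsLocallyConstant fun w => ρ w

/-- A representation is tamely ramified if it is trivial on wild inertia. -/
def IsTamelyRamified (ρ : Representation κ (WeilGroup F) V) : Prop :=
  ∀ w ∈ wildInertia F, ρ w = 1

/-- The subspace `ρ^I` of inertial invariants. -/
noncomputable abbrev inertialInvariants (ρ : Representation κ (WeilGroup F) V) : Submodule κ V :=
  Representation.invariants (ρ.comp (inertia F).subtype)

/-- The `L`-factor `L(ρ, Y) = det (1 - Y ρ(Fr) | ρ^I)⁻¹`, evaluated at a rational function `Y`,
for a Frobenius element `Fr`. -/
noncomputable def LFactor (ρ : Representation κ (WeilGroup F) V) (Fr : WeilGroup F)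
    (Y : RatFunc κ) : RatFunc κ :=
  (aeval Y (charRev (ρ.toInvariants (inertia F) Fr)))⁻¹

/-- `1 + A + ⋯ + A ^ (q - 1)`. -/
def geomSum (q : ℕ) (A : Module.End κ V) : Module.End κ V := ∑ i ∈ Finset.range q, A ^ i

end Representations

end LocalWeil

namespace LocalWeil

open Polynomial

/-! ### Linear algebra of the tame relation -/

section LinearAlgebra

variable {κ V : Type*} [Field κ] [AddCommGroup V] [Module κ V] [FiniteDimensional κ V]

/-! Write `σ = ρ s`, `Φ = ρ Fr`, `N = 1 + σ + ⋯ + σ ^ (q - 1)`. By smoothness `σ` has finite order,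
and since `s` generates tame inertia topologically, the image of inertia consists of powers of `σ`;
so `ρ^I` is `U = ker (σ - 1)` (`mem_inertialInvariants_iff`). In characteristic zero `V = U ⊕ W`
with `W = range (σ - 1)`, and `Φ` and `N` preserve both summands.

On `U`, `N` is multiplication by `q`. On `W`, `σ - 1` is invertible, and `N (σ - 1) = σ ^ q - 1`
combined with `Φ σ ^ q = σ Φ` (`frobenius_mul_pow_of_isTamelyRamified`) gives `Φ N (σ - 1) = (σ - 1)
Φ`. Hence `det N = 1` on `W` and `N Φ` is conjugate to `Φ` there, so the contributions of `W` cancel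
in the quotient and only `U` remains (`det_geomSum_and_charRev`). -/

omit [FiniteDimensional κ V] in
theorem conj_prodMap_restrict {U W : Submodule κ V} (h : IsCompl U W) (f : Module.End κ V)
    (hU : ∀ x ∈ U, f x ∈ U) (hW : ∀ x ∈ W, f x ∈ W) :
    (Submodule.prodEquivOfIsCompl U W h).conj ((f.restrict hU).prodMap (f.restrict hW)) = f := by
  rw [LinearEquiv.conj_apply, ← LinearEquiv.eq_comp_toLinearMap_symm,
    LinearEquiv.symm_symm]
  ext x <;> simp

theorem charRev_eq_mul_of_isCompl {U W : Submodule κ V} (h : IsCompl U W) (f : Module.End κ V)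
    (hU : ∀ x ∈ U, f x ∈ U) (hW : ∀ x ∈ W, f x ∈ W) :
    charRev f = charRev (f.restrict hU) * charRev (f.restrict hW) := by
  rw [charRev_eq_reverse, charRev_eq_reverse, charRev_eq_reverse, ← reverse_mul_of_domain,
    ← LinearMap.charpoly_prodMap, ← LinearEquiv.charpoly_conj (Submodule.prodEquivOfIsCompl U W h),
    conj_prodMap_restrict]

theorem det_eq_mul_of_isCompl {U W : Submodule κ V} (h : IsCompl U W) (f : Module.End κ V)
    (hU : ∀ x ∈ U, f x ∈ U) (hW : ∀ x ∈ W, f x ∈ W) :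
    LinearMap.det f = LinearMap.det (f.restrict hU) * LinearMap.det (f.restrict hW) := by
  rw [← LinearMap.det_prodMap, ← LinearMap.det_conj _ (Submodule.prodEquivOfIsCompl U W h)]
  exact congrArg LinearMap.det (conj_prodMap_restrict h f hU hW).symm

theorem charRev_eq_of_semiconj {g A B : Module.End κ V} (hg : IsUnit g) (h : g * A = B * g) :
    charRev A = charRev B := by
  obtain ⟨u, rfl⟩ := hg
  rw [charRev_eq_reverse, charRev_eq_reverse,
    ← LinearEquiv.charpoly_conj (LinearMap.GeneralLinearGroup.generalLinearEquiv κ V u) A]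
  congr 2
  ext x
  have hx := LinearMap.congr_fun h ((↑u⁻¹ : Module.End κ V) x)
  have hu : (u : Module.End κ V) ((↑u⁻¹ : Module.End κ V) x) = x := by
    rw [← Module.End.mul_apply, Units.mul_inv, Module.End.one_apply]
  rw [Module.End.mul_apply, Module.End.mul_apply, hu] at hx
  exact hx

theorem charRev_smul (c : κ) (A : Module.End κ V) : charRev (c • A) = (charRev A).comp (C c * X) := by
  rw [← coe_compRingHom_apply, charRev, charRev, Matrix.charpolyRev, Matrix.charpolyRev,
    RingHom.map_det]
  congr 1
  refine Matrix.ext fun i j => ?_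
  by_cases hij : i = j <;> simp [hij] <;> ring

theorem charRev_ne_zero (A : Module.End κ V) : charRev A ≠ 0 := by
  intro h
  have := Matrix.eval_charpolyRev
    (M := LinearMap.toMatrix (Module.finBasis κ V) (Module.finBasis κ V) A)
  rw [show Matrix.charpolyRev _ = 0 from h] at this
  simp at this

/-- A finite order automorphism in characteristic zero acts without fixed vectors on the range
of `σ - 1`. -/
theorem isCompl_fixed_range_sub_one [CharZero κ] {σ : Module.End κ V} {n : ℕ} (hn : n ≠ 0)
    (hσ : σ ^ n = 1) {U : Submodule κ V} (hU : ∀ x, x ∈ U ↔ σ x = x) :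
    IsCompl U (LinearMap.range (σ - 1)) := by
  have hker : U = LinearMap.ker (σ - 1) := by
    ext x
    simp [hU, sub_eq_zero]
  rw [hker]
  have hdisj : Disjoint (LinearMap.ker (σ - 1)) (LinearMap.range (σ - 1)) := by
    rw [Submodule.disjoint_def]
    rintro x hx ⟨y, rfl⟩
    have hfix : σ ((σ - 1) y) = (σ - 1) y := by simpa [sub_eq_zero] using hx
    -- If `σ` fixes `(σ - 1) y`, the orbit of `y` grows linearly; returning to `y` after `n` steps
    -- forces the increment to vanish.
    have hpow : ∀ m : ℕ, (σ ^ m) y = y + m • (σ - 1) y := by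
      intro m
      induction m with
      | zero => simp
      | succ m ih =>
        rw [pow_succ', Module.End.mul_apply, ih, map_add, map_nsmul, hfix, succ_nsmul]
        simp only [LinearMap.sub_apply, Module.End.one_apply]
        abel
    have h := hpow n
    rw [hσ, Module.End.one_apply, left_eq_add, ← Nat.cast_smul_eq_nsmul κ] at h
    exact (smul_eq_zero.1 h).resolve_left (Nat.cast_ne_zero.2 hn)
  refine ⟨hdisj, codisjoint_iff.2 (Submodule.eq_top_of_disjoint _ _ ?_ hdisj)⟩
  rw [add_comm, LinearMap.finrank_range_add_finrank_ker]

/-- The linear algebra of a tame relation `Φ σ ^ q = σ Φ` with `σ` of finite order. -/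
theorem det_geomSum_and_charRev [CharZero κ] {σ Φ : Module.End κ V} {n q k : ℕ} (hn : n ≠ 0)
    (hσ : σ ^ n = 1) (hΦ : IsUnit Φ) (hq : Φ * σ ^ q = σ * Φ) (hk : Φ * σ = σ ^ k * Φ)
    {U : Submodule κ V} (hU : ∀ x, x ∈ U ↔ σ x = x) (hΦU : ∀ x ∈ U, Φ x ∈ U) :
    LinearMap.det (geomSum q σ) = (q : κ) ^ Module.finrank κ U ∧
      ∃ p : κ[X], p ≠ 0 ∧ charRev Φ = charRev (Φ.restrict hΦU) * p ∧
        charRev (geomSum q σ * Φ) = (charRev (Φ.restrict hΦU)).comp (C (q : κ) * X) * p := by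
  set N := geomSum q σ with hN
  set W := LinearMap.range (σ - 1) with hWdef
  have hc : IsCompl U W := isCompl_fixed_range_sub_one hn hσ hU
  have hNσ : Commute N (σ - 1) :=
    (Commute.sum_left _ _ _ fun i _ => (Commute.refl σ).pow_left i).sub_right (Commute.one_right N)
  have hNgeom : N * (σ - 1) = σ ^ q - 1 := geom_sum_mul σ q
  have hNU : ∀ x ∈ U, N x = (q : κ) • x := by
    intro x hx
    have : ∀ i : ℕ, (σ ^ i) x = x := fun i => by
      rw [Module.End.pow_apply]
      exact Function.iterate_fixed ((hU x).1 hx) i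
    simp [hN, geomSum, this, Nat.cast_smul_eq_nsmul]
  have hNU' : ∀ x ∈ U, N x ∈ U := fun x hx => hNU x hx ▸ U.smul_mem _ hx
  have hσW : ∀ x ∈ W, (σ - 1) x ∈ W := fun x _ => ⟨x, rfl⟩
  have hNW : ∀ x ∈ W, N x ∈ W := by
    rintro _ ⟨y, rfl⟩
    exact ⟨N y, (LinearMap.congr_fun hNσ.eq y).symm⟩
  -- The relation `hq` does not move `σ - 1` to the left of `Φ`; `hk` does: `Φ (σ - 1) = (σ ^ k - 1)
  -- Φ`, which is divisible by `σ - 1` on the left.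
  have hΦW : ∀ x ∈ W, Φ x ∈ W := by
    rintro _ ⟨y, rfl⟩
    refine ⟨geomSum k σ (Φ y), ?_⟩
    have h : (σ - 1) * geomSum k σ * Φ = Φ * (σ - 1) := by
      rw [geomSum, mul_geom_sum, mul_sub, hk, sub_mul, one_mul, mul_one]
    exact LinearMap.congr_fun h y
  have hNΦU : ∀ x ∈ U, (N * Φ) x ∈ U := fun x hx => hNU' _ (hΦU x hx)
  have hNΦW : ∀ x ∈ W, (N * Φ) x ∈ W := fun x hx => hNW _ (hΦW x hx)
  have hrel : Φ * N * (σ - 1) = (σ - 1) * Φ := by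
    rw [mul_assoc, hNgeom, mul_sub, hq, sub_mul, one_mul, mul_one]
  have hσunit : IsUnit ((σ - 1).restrict hσW) := by
    rw [LinearMap.isUnit_iff_ker_eq_bot, LinearMap.ker_eq_bot']
    rintro ⟨x, hx⟩ h
    have h' : (σ - 1) x = 0 := congrArg Subtype.val h
    have hxU : x ∈ U := (hU x).2 (by simpa [sub_eq_zero] using h')
    exact Subtype.ext ((Submodule.disjoint_def.1 hc.disjoint) x hxU hx)
  have hΦunit : IsUnit (Φ.restrict hΦW) := by
    rw [LinearMap.isUnit_iff_ker_eq_bot] at hΦ ⊢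
    rw [LinearMap.ker_eq_bot'] at hΦ ⊢
    rintro ⟨x, hx⟩ h
    exact Subtype.ext (hΦ x (congrArg Subtype.val h))
  have hrelW : Φ.restrict hΦW * N.restrict hNW * (σ - 1).restrict hσW =
      (σ - 1).restrict hσW * Φ.restrict hΦW :=
    LinearMap.ext fun x => Subtype.ext (LinearMap.congr_fun hrel x)
  have hdetW : LinearMap.det (N.restrict hNW) = 1 := by
    have h := congrArg LinearMap.det hrelW
    rw [map_mul, map_mul, map_mul] at h
    have h₁ := (hΦunit.map LinearMap.det).ne_zero
    have h₂ := (hσunit.map LinearMap.det).ne_zero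
    apply mul_left_cancel₀ (mul_ne_zero h₁ h₂)
    linear_combination h
  have hcharW : charRev ((N * Φ).restrict hNΦW) = charRev (Φ.restrict hΦW) := by
    obtain ⟨u, hu⟩ := hσunit
    -- With `u = σ - 1` on `W`, the relation reads `Φ N = u Φ u⁻¹`, so `u⁻¹ Φ` intertwines `N Φ`
    -- with `Φ`.
    refine charRev_eq_of_semiconj (g := (↑u⁻¹ : Module.End κ W) * Φ.restrict hΦW) (u⁻¹.isUnit.mul hΦunit) ?_
    rw [← hu] at hrelW
    have hmul : (N * Φ).restrict hNΦW = N.restrict hNW * Φ.restrict hΦW := rfl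
    have hrelW' : Φ.restrict hΦW * N.restrict hNW = ↑u * Φ.restrict hΦW * ↑u⁻¹ := by
      rw [← hrelW, mul_assoc _ (u : Module.End κ W), Units.mul_inv, mul_one]
    rw [hmul, mul_assoc, ← mul_assoc (Φ.restrict hΦW), hrelW', ← mul_assoc, ← mul_assoc,
      ← mul_assoc, Units.inv_mul, one_mul, mul_assoc]
  have hNΦU' : (N * Φ).restrict hNΦU = (q : κ) • Φ.restrict hΦU :=
    LinearMap.ext fun x => Subtype.ext (hNU _ (hΦU x x.2))
  have hNUres : N.restrict hNU' = (q : κ) • LinearMap.id :=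
    LinearMap.ext fun x => Subtype.ext (hNU _ x.2)
  refine ⟨?_, charRev (Φ.restrict hΦW), charRev_ne_zero _,
    charRev_eq_mul_of_isCompl hc Φ hΦU hΦW, ?_⟩
  · rw [det_eq_mul_of_isCompl hc N hNU' hNW, hdetW, mul_one, hNUres, LinearMap.det_smul,
      LinearMap.det_id, mul_one]
  · rw [charRev_eq_mul_of_isCompl hc (N * Φ) hNΦU hNΦW, hcharW, hNΦU', charRev_smul]

end LinearAlgebra

end LocalWeil

namespace LocalWeil

/-! ### The action of Frobenius on tame inertia -/

section TameRelation

variable {F : Type*} [NontriviallyNormedField F] [IsUltrametricDist F]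

theorem absVal_mul [CompleteSpace F] (x y : AlgebraicClosure F) :
    absVal F (x * y) = absVal F x * absVal F y :=
  map_mul (spectralMulAlgNorm F (AlgebraicClosure F)) x y

omit [IsUltrametricDist F] in
theorem absVal_pos {x : AlgebraicClosure F} (hx : x ≠ 0) : 0 < absVal F x :=
  spectralNorm_zero_lt hx (Algebra.IsAlgebraic.isAlgebraic (R := F) x)

theorem absVal_div_eq_one [CompleteSpace F] {x y : AlgebraicClosure F} (hy : y ≠ 0)
    (h : absVal F x = absVal F y) : absVal F (x / y) = 1 := by
  have h₁ := absVal_mul (x / y) y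
  rw [div_mul_cancel₀ x hy, h] at h₁
  exact mul_right_cancel₀ (absVal_pos hy).ne' (by rw [one_mul]; exact h₁.symm)

/-- Inertia acts on `x`, up to a principal unit, by a unit `g x / x` whose powers describe the
powers of `g`. -/
theorem absVal_pow_apply_div_sub_lt [CompleteSpace F] {g : AlgebraicClosure F ≃ₐ[F] AlgebraicClosure F}
    (hg : g ∈ inertiaGal F) {x : AlgebraicClosure F} (hx : x ≠ 0) (k : ℕ) :
    absVal F ((g ^ k) x / x - (g x / x) ^ k) < 1 := by
  have hu : absVal F (g x / x) = 1 := absVal_div_eq_one hx (absVal_equiv g x)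
  induction k with
  | zero =>
    rw [pow_zero, pow_zero, AlgEquiv.one_apply, div_self hx, sub_self]
    exact lt_of_eq_of_lt spectralNorm_zero one_pos
  | succ k ih =>
    have hv : absVal F ((g ^ k) x / x) = 1 := absVal_div_eq_one hx (absVal_equiv _ x)
    have h₁ := hg _ hv.le
    have hmul : (g ^ (k + 1)) x / x = g ((g ^ k) x / x) * (g x / x) := by
      have hgx : g x ≠ 0 := (map_ne_zero g).2 hx
      rw [pow_succ', AlgEquiv.mul_apply, map_div₀]
      field_simp
    rw [hmul, pow_succ]
    refine absVal_sub_lt (y := (g ^ k) x / x * (g x / x)) ?_ ?_ <;>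
      rw [← sub_mul, absVal_mul, hu, mul_one] <;> assumption

/-- The tame relation: an element `φ` acting as the arithmetic Frobenius on residue fields conjugates
inertia elements into their `q`-th powers, modulo wild inertia. -/
theorem conj_mul_inv_pow_mem_wildInertiaGal [CompleteSpace F]
    {g φ : AlgebraicClosure F ≃ₐ[F] AlgebraicClosure F} (hg : g ∈ inertiaGal F)
    (hφ : ActsAsFrobPow φ 1 0) :
    (g ^ residueCard F)⁻¹ * (φ * g * φ⁻¹) ∈ wildInertiaGal F := by
  intro x hx
  set q := residueCard F
  set y := φ⁻¹ x with hy
  have hφy : φ y = x := φ.apply_symm_apply x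
  have hy0 : y ≠ 0 := (map_ne_zero φ⁻¹).2 hx
  have hu : absVal F (g y / y) = 1 := absVal_div_eq_one hy0 (absVal_equiv g y)
  have hv : absVal F (g x / x) = 1 := absVal_div_eq_one hx (absVal_equiv g x)
  have hxy : absVal F (x / y) = 1 :=
    absVal_div_eq_one hy0 (absVal_equiv φ⁻¹ x).symm
  have h₁ : absVal F (φ (g y) / x - (g y / y) ^ q) < 1 := by
    simpa [map_div₀, hφy] using hφ (g y / y) hu.le
  -- Since `x / y` is a unit, inertia fixes it modulo the maximal ideal, so `g` has the same tame
  -- character value at `x` and at `y`. Applying `φ` raises this value to the `q`-th power.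
  have h₂ : absVal F (g x / x - g y / y) < 1 := by
    have h := hg (x / y) hxy.le
    have hgy : g y ≠ 0 := (map_ne_zero g).2 hy0
    have hgy' : absVal F (g y / x) = 1 := by
      refine absVal_div_eq_one hx ?_
      rw [absVal_equiv, hy, absVal_equiv]
    have hfac : g x / x - g y / y = (g (x / y) - x / y) * (g y / x) := by
      rw [map_div₀]
      field_simp
    rw [hfac, absVal_mul, hgy', mul_one]
    exact h
  have h₃ := absVal_pow_apply_div_sub_lt hg hx q
  have h₄ : absVal F (φ (g y) / x - (g ^ q) x / x) < 1 := by
    refine absVal_sub_lt (absVal_sub_lt h₁ ?_) (by rw [absVal_sub_comm]; exact h₃)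
    rw [absVal_sub_comm]
    exact absVal_pow_sub_pow_lt hv.le hu.le h₂ q
  have h₅ : absVal F (φ (g y) - (g ^ q) x) < absVal F x := by
    have hfac : φ (g y) - (g ^ q) x = (φ (g y) / x - (g ^ q) x / x) * x := by
      field_simp
    rw [hfac, absVal_mul]
    exact mul_lt_of_lt_one_left (absVal_pos hx) h₄
  rw [← absVal_equiv (g ^ q), map_sub]
  have : (g ^ q) (((g ^ q)⁻¹ * (φ * g * φ⁻¹)) x) = φ (g y) :=
    (g ^ q).apply_symm_apply _
  rw [this]
  exact h₅

end TameRelation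

/-! ### The image of inertia under a smooth tame representation -/

section Smooth

variable {F : Type*} [NontriviallyNormedField F] [IsUltrametricDist F]

/-- Every automorphism has a positive power in a given neighbourhood of the identity. -/
theorem exists_pow_mem_of_mem_nhds_one {K L : Type*} [Field K] [Field L] [Algebra K L]
    {S : Set (L ≃ₐ[K] L)} (hS : S ∈ nhds 1) (g : L ≃ₐ[K] L) : ∃ n : ℕ, n ≠ 0 ∧ g ^ n ∈ S := by
  obtain ⟨E, hE, hES⟩ := (krullTopology_mem_nhds_one_iff K L S).1 hS
  -- Pigeonhole: the finite extension `E` has only finitely many embeddings, so two powers of `g`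
  -- agree on it.
  obtain ⟨i, j, hij, h⟩ := Finite.exists_ne_map_eq_of_infinite
    fun i : ℕ => ((g ^ i : L ≃ₐ[K] L) : L →ₐ[K] L).comp E.val
  wlog hlt : i < j generalizing i j
  · exact this j i hij.symm h.symm (lt_of_le_of_ne (not_lt.1 hlt) hij.symm)
  refine ⟨j - i, (Nat.sub_pos_of_lt hlt).ne', hES ?_⟩
  rw [SetLike.mem_coe, IntermediateField.mem_fixingSubgroup_iff]
  intro x hx
  have hx' : (g ^ i) x = (g ^ j) x := DFunLike.congr_fun h (⟨x, hx⟩ : E)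
  apply (g ^ i).injective
  rw [← AlgEquiv.mul_apply, ← pow_add, Nat.add_sub_cancel' hlt.le, hx']

variable {κ V : Type*} [Field κ] [AddCommGroup V] [Module κ V]

theorem WeilGroup.nhds_one : nhds (1 : WeilGroup F) =
    (nhds (1 : AlgebraicClosure F ≃ₐ[F] AlgebraicClosure F)).comap (WeilGroup.toGal F) ⊓
      (@nhds (WeilGroup F ⧸ inertia F) ⊥ 1).comap QuotientGroup.mk := by
  refine (nhds_inf (t₁ := .induced (WeilGroup.toGal F) inferInstance)
    (t₂ := .induced QuotientGroup.mk ⊥)).trans ?_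
  rw [nhds_induced, @nhds_induced _ _ ⊥, map_one]
  rfl

theorem exists_pow_eq_one_of_isSmooth {ρ : Representation κ (WeilGroup F) V} (hρ : IsSmooth ρ)
    (s : inertia F) : ∃ n : ℕ, n ≠ 0 ∧ ρ s ^ n = 1 := by
  have hnhds : {w : WeilGroup F | ρ w = 1} ∈ nhds (1 : WeilGroup F) :=
    (hρ.isOpen_fiber 1).mem_nhds (map_one ρ)
  rw [WeilGroup.nhds_one, Filter.mem_inf_iff] at hnhds
  obtain ⟨A, hA, B, hB, hAB⟩ := hnhds
  obtain ⟨S, hS, hSA⟩ := Filter.mem_comap.1 hA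
  -- The discrete coset space imposes no condition inside inertia, so only the Krull neighbourhood
  -- matters.
  have hBI : ∀ w ∈ inertia F, w ∈ B := by
    obtain ⟨T, hT, hTB⟩ := Filter.mem_comap.1 hB
    intro w hw
    apply hTB
    rw [Set.mem_preimage, (QuotientGroup.eq_one_iff w).2 hw]
    exact @mem_of_mem_nhds _ ⊥ _ _ hT
  obtain ⟨n, hn, hpow⟩ := exists_pow_mem_of_mem_nhds_one hS (WeilGroup.toGal F s)
  refine ⟨n, hn, ?_⟩
  have hmem : (s : WeilGroup F) ^ n ∈ {w : WeilGroup F | ρ w = 1} := by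
    rw [hAB]
    refine ⟨hSA ?_, hBI _ (Subgroup.pow_mem _ s.2 n)⟩
    rw [Set.mem_preimage, map_pow]
    exact hpow
  rw [← map_pow]
  exact hmem

/-- The image of inertia under a smooth tame representation is generated by the image of a tame
generator. -/
theorem exists_zpow_of_isTameGenerator {ρ : Representation κ (WeilGroup F) V} (hρ : IsSmooth ρ)
    (htame : IsTamelyRamified ρ) {s : inertia F} (hs : IsTameGenerator s) (w : inertia F) :
    ∃ k : ℤ, ρ w = ρ ((s : WeilGroup F) ^ k) := by
  set P := (wildInertia F).subgroupOf (inertia F)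
  set O : Set (inertia F) := {t | ρ t = ρ w} with hO
  have hOopen : IsOpen O := (hρ.isOpen_fiber (ρ w)).preimage continuous_subtype_val
  -- Tameness makes the fibre `O` a union of cosets of wild inertia, so its image in the quotient is
  -- open and meets the dense powers of `s`.
  have hpre : (QuotientGroup.mk : inertia F → inertia F ⧸ P) ⁻¹' (QuotientGroup.mk '' O) = O := by
    refine subset_antisymm ?_ (Set.subset_preimage_image _ _)
    rintro t ⟨t', ht', h⟩
    have h₁ : t'⁻¹ * t ∈ P := QuotientGroup.eq.1 h
    have h₂ : ρ ((t' : WeilGroup F)⁻¹ * t) = 1 := htame _ (Subgroup.mem_subgroupOf.1 h₁)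
    change ρ t = ρ w
    rw [← ht', ← mul_inv_cancel_left (t' : WeilGroup F) (t : WeilGroup F), map_mul, h₂, mul_one]
  have hopen : IsOpen ((QuotientGroup.mk : inertia F → inertia F ⧸ P) '' O) := by
    refine isOpen_coinduced.2 ?_
    exact hpre.symm ▸ hOopen
  obtain ⟨z, ⟨t, ht, rfl⟩, k, hk⟩ := hs.inter_open_nonempty _ hopen ⟨_, w, rfl, rfl⟩
  refine ⟨k, ?_⟩
  have hmem : s ^ k ∈ O := by
    rw [← hpre]
    exact ⟨t, ht, hk.symm⟩
  have h : ρ ((s ^ k : inertia F) : WeilGroup F) = ρ w := hmem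
  rw [← h, Subgroup.coe_zpow]

theorem exists_pow_of_isTameGenerator {ρ : Representation κ (WeilGroup F) V} (hρ : IsSmooth ρ)
    (htame : IsTamelyRamified ρ) {s : inertia F} (hs : IsTameGenerator s) (w : inertia F) :
    ∃ k : ℕ, ρ w = ρ s ^ k := by
  obtain ⟨n, hn, hpow⟩ := exists_pow_eq_one_of_isSmooth hρ s
  obtain ⟨k, hk⟩ := exists_zpow_of_isTameGenerator hρ htame hs w
  have hn' : (n : ℤ) ≠ 0 := Nat.cast_ne_zero.2 hn
  refine ⟨(k % n).toNat, ?_⟩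
  rw [hk, ← map_pow, ← zpow_natCast, Int.toNat_of_nonneg (Int.emod_nonneg k hn')]
  conv_lhs => rw [← Int.emod_add_mul_ediv k n, zpow_add, zpow_mul, zpow_natCast, map_mul]
  have hone : ρ (((s : WeilGroup F) ^ n) ^ (k / n)) = 1 := by
    have hker : (s : WeilGroup F) ^ n ∈ MonoidHom.ker ρ := by
      rw [MonoidHom.mem_ker, map_pow, hpow]
    exact MonoidHom.mem_ker.1 (Subgroup.zpow_mem _ hker _)
  rw [hone, mul_one]

theorem mem_inertialInvariants_iff {ρ : Representation κ (WeilGroup F) V} (hρ : IsSmooth ρ)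
    (htame : IsTamelyRamified ρ) {s : inertia F} (hs : IsTameGenerator s) (x : V) :
    x ∈ inertialInvariants ρ ↔ ρ s x = x := by
  refine ⟨fun h => h s, fun h w => ?_⟩
  obtain ⟨k, hk⟩ := exists_pow_of_isTameGenerator hρ htame hs w
  change ρ w x = x
  rw [hk, Module.End.pow_apply]
  exact Function.iterate_fixed h k

/-- The inverse of a geometric Frobenius acts as `x ↦ x ^ q`, so `Fr⁻¹ s Fr` and `s ^ q` differ by a
wild element, which `ρ` kills. -/
theorem frobenius_mul_pow_of_isTamelyRamified [CompleteSpace F]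
    {ρ : Representation κ (WeilGroup F) V} (htame : IsTamelyRamified ρ) (s : inertia F)
    {Fr : WeilGroup F} (hFr : IsGeometricFrobenius Fr) :
    ρ Fr * ρ s ^ residueCard F = ρ s * ρ Fr := by
  have hφ : ActsAsFrobPow (WeilGroup.toGal F Fr⁻¹) 1 0 := by
    intro x hx
    have h := hFr (WeilGroup.toGal F Fr⁻¹ x) (by rw [absVal_equiv]; exact hx)
    rw [absVal_sub_comm]
    rw [map_inv] at h ⊢
    rwa [show WeilGroup.toGal F Fr ((WeilGroup.toGal F Fr)⁻¹ x) = x from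
      (WeilGroup.toGal F Fr).apply_symm_apply x] at h
  have hmem := conj_mul_inv_pow_mem_wildInertiaGal (g := WeilGroup.toGal F s) s.2 hφ
  have h₁ : ((s : WeilGroup F) ^ residueCard F)⁻¹ * (Fr⁻¹ * s * Fr⁻¹⁻¹) ∈ wildInertia F := by
    change WeilGroup.toGal F _ ∈ wildInertiaGal F
    simpa only [map_mul, map_inv, map_pow] using hmem
  have h₂ := htame _ h₁
  have h₃ : (s : WeilGroup F) * Fr = Fr * (s : WeilGroup F) ^ residueCard F *
      (((s : WeilGroup F) ^ residueCard F)⁻¹ * (Fr⁻¹ * s * Fr⁻¹⁻¹)) := by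
    group
  rw [← map_mul, h₃, map_mul, h₂, mul_one, map_mul, map_pow]

end Smooth

end LocalWeil

/-! ### `L`-factors and the conclusion -/

namespace LocalWeil

open Polynomial

theorem LFactor_C_mul_X {κ V : Type*} [Field κ] [AddCommGroup V] [Module κ V]
    [FiniteDimensional κ V] {F : Type*} [NontriviallyNormedField F] [IsUltrametricDist F]
    (ρ : Representation κ (WeilGroup F) V) (Fr : WeilGroup F) (c : κ) :
    LFactor ρ Fr (RatFunc.C c * RatFunc.X) = (algebraMap κ[X] (RatFunc κ)
      ((charRev (ρ.toInvariants (inertia F) Fr)).comp (C c * X)))⁻¹ := by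
  rw [LFactor, comp_eq_aeval, ← aeval_algebraMap_apply, map_mul, RatFunc.algebraMap_C,
    RatFunc.algebraMap_X]

theorem LFactor_X {κ V : Type*} [Field κ] [AddCommGroup V] [Module κ V]
    [FiniteDimensional κ V] {F : Type*} [NontriviallyNormedField F] [IsUltrametricDist F]
    (ρ : Representation κ (WeilGroup F) V) (Fr : WeilGroup F) :
    LFactor ρ Fr RatFunc.X =
      (algebraMap κ[X] (RatFunc κ) (charRev (ρ.toInvariants (inertia F) Fr)))⁻¹ := by
  simpa using LFactor_C_mul_X ρ Fr 1

end LocalWeil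

theorem theorem5p1
    {F : Type*} [NontriviallyNormedField F] [IsUltrametricDist F] [LocallyCompactSpace F]
    {κ : Type*} [Field κ] [CharZero κ]
    {V : Type*} [AddCommGroup V] [Module κ V] [FiniteDimensional κ V]
    (ρ : Representation κ (LocalWeil.WeilGroup F) V)
    (hsemisimple : ρ.IsSemisimpleRepresentation)
    (hsmooth : LocalWeil.IsSmooth ρ)
    (htame : LocalWeil.IsTamelyRamified ρ)
    (s : LocalWeil.inertia F) (hs : LocalWeil.IsTameGenerator s)
    (Fr : LocalWeil.WeilGroup F) (hFr : LocalWeil.IsGeometricFrobenius Fr) :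
    LinearMap.det (LocalWeil.geomSum (LocalWeil.residueCard F) (ρ s)) =
        (LocalWeil.residueCard F : κ) ^ Module.finrank κ (LocalWeil.inertialInvariants ρ) ∧
      (algebraMap (Polynomial κ) (RatFunc κ) (LocalWeil.charRev (ρ Fr))) /
          (algebraMap (Polynomial κ) (RatFunc κ) (LocalWeil.charRev
            (LocalWeil.geomSum (LocalWeil.residueCard F) (ρ s) * ρ Fr))) =
        LocalWeil.LFactor ρ Fr (RatFunc.C (LocalWeil.residueCard F : κ) * RatFunc.X) /
          LocalWeil.LFactor ρ Fr RatFunc.X := by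
  -- Completeness makes the spectral norm multiplicative, as the tame relation requires.
  have : CompleteSpace F := IsRightUniformAddGroup.completeSpace_of_weaklyLocallyCompactSpace
  obtain ⟨n, hn, hσ⟩ := LocalWeil.exists_pow_eq_one_of_isSmooth hsmooth s
  -- Inertia is normal, so the conjugate of `s` by `Fr` also acts as a power of `σ`.
  obtain ⟨k, hk⟩ := LocalWeil.exists_pow_of_isTameGenerator hsmooth htame hs
    ⟨Fr * s * Fr⁻¹, (inferInstance : (LocalWeil.inertia F).Normal).conj_mem _ s.2 Fr⟩
  have hk' : ρ Fr * ρ s = ρ s ^ k * ρ Fr := by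
    rw [← hk, ← map_mul, ← map_mul, inv_mul_cancel_right]
  obtain ⟨hdet, p, hp, h₁, h₂⟩ := LocalWeil.det_geomSum_and_charRev hn hσ
    ((Group.isUnit Fr).map ρ)
    (LocalWeil.frobenius_mul_pow_of_isTamelyRamified htame s hFr) hk'
    (LocalWeil.mem_inertialInvariants_iff hsmooth htame hs)
    (ρ.le_comap_invariants (LocalWeil.inertia F) Fr)
  refine ⟨hdet, ?_⟩
  have hp' : algebraMap (Polynomial κ) (RatFunc κ) p ≠ 0 := RatFunc.algebraMap_ne_zero hp
  rw [h₁, h₂, map_mul, map_mul, mul_div_mul_right _ _ hp', LocalWeil.LFactor_C_mul_X,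
    LocalWeil.LFactor_X, inv_div_inv]
  rfl
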